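/- **Setting.** Let $R$ be a commutative ring with $m\ge 0$ commuting derivations $\partial_1,\dots,\partial_m$ and an action $g\mapsto\hat g$ of a discrete group $\Gamma$ by ring automorphisms commuting with the $\partial_\ell$ (trivial $\Gamma$ is the differential case; $m=0$ and trivial $\Gamma$ is the finite-dimensional case). In any such ring write $a\sim b$ if $a-b\in\sum_\ell\mathrm{Im}\,\partial_\ell+\sum_{g}\mathrm{Im}(\hat g-\hat e)$; call an element constant if all $\partial_\ell$ annihilate it and $\Gamma$ fixes it. Differential operators are finite sums $\sum a_{g,\sigma}\,\hat g\,\partial^\sigma$, and $\langle u,X\rangle=\sum_i u_iX_i$. Identities between differential operators with coefficients in $R$ are required over every extension $\tilde R\supset R$ of such rings. Let $\mathcal G=R^N$ be a Lie algebra whose bracket is given by bilinear differential operators (skewsymmetric and satisfying the Jacobi identity), and let $\chi$ be a representation of $\mathcal G$ on $V=R^n$, with $(X,v)\mapsto X.v=\chi(X)(v)$ given by bilinear differential operators. The coadjoint action $X^{\cdot}u$ on $\mathcal G^*=R^N$ and the map $\nabla:V\times V^*\to\mathcal G^*$ are the differential operators determined by $$\langle X^{\cdot}u,Y\rangle\sim-\langle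 u,[X,Y]\rangle,\qquad \langle v\nabla v^*,X\rangle\sim\langle v^*,X.v\rangle .$$ Let $\mathcal O:\mathcal G^*\to\mathcal G$ be an $\mathcal O$-operator, i.e. a matrix differential operator with $$\langle u,\mathcal O(w)\rangle\sim-\langle w,\mathcal O(u)\rangle,\qquad \mathcal O\big(\mathcal O(u)^{\cdot}w-\mathcal O(w)^{\cdot}u\big)=[\mathcal O(u),\mathcal O(w)].$$ Let $C=\mathrm{Fun}(V\oplus V^*)=R[x_\alpha^{(g|\sigma)},p_\alpha^{(g|\sigma)}]$, $1\le\alpha\le n$, $g\in\Gamma$, $\sigma\in\mathbf Z_+^m$, with $\partial_\ell$ and $\Gamma$ extended by $\partial_\ell q^{(g|\sigma)}=q^{(g|\sigma+1_\ell)}$ and $\hat h\,q^{(g|\sigma)}=q^{(hg|\sigma)}$, and let $$\frac{\delta H}{\delta q}=\sum_{g,\sigma}\hat g^{-1}(-\partial)^\sigma\frac{\partial H}{\partial q^{(g|\sigma)}}\qquad\text{for a generator } q .$$ A bracket $\{\,,\}:C\times C\to C$, considered modulo $\sim$, is called Poisson if there is a matrix $B$ of differential operators over $C$ such that, for all $H,F,G\in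 C$, with $\mathbf q=(\mathbf x,\mathbf p)$, $$\{H,F\}\sim\Big(\frac{\delta F}{\delta \mathbf q}\Big)^{t}B\Big(\frac{\delta H}{\delta\mathbf q}\Big),\qquad \{H,F\}\sim-\{F,H\},\qquad \{\{H,F\},G\}+\{\{F,G\},H\}+\{\{G,H\},F\}\sim0 .$$ Let $\{\,,\}_1$ be the canonical symplectic bracket on $C$, $$\{H,F\}_1\sim-\Big(\frac{\delta F}{\delta\mathbf x}\Big)^t\frac{\delta H}{\delta\mathbf p}+\Big(\frac{\delta F}{\delta\mathbf p}\Big)^t\frac{\delta H}{\delta\mathbf x},$$ and let $\{\,,\}_2$ be the quadratic bracket $\{H,F\}_2\sim(\delta F/\delta\mathbf q)^tB(\delta H/\delta\mathbf q)$ whose matrix $B=\begin{pmatrix}B_{xx}&B_{xp}\\B_{px}&B_{pp}\end{pmatrix}$ is given by $$\mathbf N^tB_{xx}(\mathbf M)\sim\langle\mathbf x\nabla\mathbf M,\mathcal O(\mathbf x\nabla\mathbf N)\rangle,\qquad \mathbf N^tB_{xp}(\mathbf M)\sim-\langle\mathbf M\nabla\mathbf p,\mathcal O(\mathbf x\nabla\mathbf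 N)\rangle,$$ $$\mathbf N^tB_{px}(\mathbf M)\sim-\langle\mathbf x\nabla\mathbf M,\mathcal O(\mathbf N\nabla\mathbf p)\rangle,\qquad \mathbf N^tB_{pp}(\mathbf M)\sim\langle\mathbf M\nabla\mathbf p,\mathcal O(\mathbf N\nabla\mathbf p)\rangle .$$ **Proposition 9.20.** The brackets $\{\,,\}_1$ and $\{\,,\}_2$ are compatible: for all constants $a,b\in R$ the bracket $a\{\,,\}_1+b\{\,,\}_2$ is again a Poisson bracket on $C$. -/

import Mathlib

universe u v

/-- A commutative ring with `m` commuting derivations and an action of a (discrete) group `Γ` by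
ring automorphisms commuting with the derivations.  Trivial `Γ`: differential rings;
`m = 0` and trivial `Γ`: plain commutative rings. -/
class DDRing (m : ℕ) (Γ : Type v) [Group Γ] (R : Type u) [CommRing R] where
  der : Fin m → Derivation ℤ R R
  shift : Γ →* RingAut R
  der_comm : ∀ i j a, der i (der j a) = der j (der i a)
  shift_der : ∀ g i a, shift g (der i a) = der i (shift g a)

namespace DDRing

section Ring

variable {m : ℕ} {Γ : Type v} [Group Γ] {R : Type u} [CommRing R] [DDRing m Γ R]

/-- The iterated derivation `∂^σ = ∂₁^{σ₁} ⋯ ∂ₘ^{σₘ}` on `R`. -/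
def iterDer (Γ : Type v) [Group Γ] [DDRing m Γ R] (σ : Fin m → ℕ) : Module.End ℤ R :=
  (List.ofFn fun i => ((der (Γ := Γ) i : Derivation ℤ R R) : Module.End ℤ R) ^ σ i).prod

/-- The operator `ĝ ∂^σ` on `R`, for `θ = (g, σ)`. -/
def act (θ : Γ × (Fin m → ℕ)) (a : R) : R :=
  shift m θ.1 (iterDer Γ θ.2 a)

/-- The adjoint operator `(ĝ ∂^σ)† = (-1)^{|σ|} ĝ⁻¹ ∂^σ` on `R`, for `θ = (g, σ)`. -/
def adj (θ : Γ × (Fin m → ℕ)) (a : R) : R :=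
  (-1) ^ (∑ i, θ.2 i) * shift m θ.1⁻¹ (iterDer Γ θ.2 a)

/-- `∑ Im ∂ₗ + ∑ Im (ĝ - ê)`. -/
def trivialElts (m : ℕ) (Γ : Type v) [Group Γ] (R : Type u) [CommRing R] [DDRing m Γ R] :
    AddSubgroup R :=
  AddSubgroup.closure
    ({x | ∃ (i : Fin m) (a : R), x = der (Γ := Γ) i a} ∪
      {x | ∃ (g : Γ) (a : R), x = shift m g a - a})

/-- `a ∼ b`: equality modulo `∑ Im ∂ₗ + ∑ Im (ĝ - ê)`. -/
def Sim (m : ℕ) (Γ : Type v) [Group Γ] {R : Type u} [CommRing R] [DDRing m Γ R] (a b : R) : Prop :=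
  a - b ∈ trivialElts m Γ R

/-- Constants of `R`: annihilated by all derivations and fixed by `Γ`. -/
def IsConst (m : ℕ) (Γ : Type v) [Group Γ] {R : Type u} [CommRing R] [DDRing m Γ R] (c : R) :
    Prop :=
  (∀ i : Fin m, der (Γ := Γ) i c = 0) ∧ ∀ g : Γ, shift m g c = c

end Ring

/-- The pairing `⟨u, X⟩ = uᵗ X` between `(R^N)^* = R^N` and `R^N`. -/
def pair {R : Type u} [CommRing R] {ι : Type*} [Fintype ι] (u X : ι → R) : R := ∑ i, u i * X i

/-- `φ : R → S` exhibits `S` as a differential-difference extension of `R`. -/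
structure IsExt (m : ℕ) (Γ : Type v) [Group Γ] {R : Type*} {S : Type*} [CommRing R] [CommRing S]
    [DDRing m Γ R] [DDRing m Γ S] (φ : R →+* S) : Prop where
  inj : Function.Injective φ
  map_der : ∀ (i : Fin m) (a : R), φ (der (Γ := Γ) i a) = der (Γ := Γ) i (φ a)
  map_shift : ∀ (g : Γ) (a : R), φ (shift m g a) = shift m g (φ a)

/-- The coefficients of a matrix `R^ι → R^κ` of differential(-difference) operators. -/
abbrev MatOp (m : ℕ) (Γ : Type v) (R : Type u) [CommRing R] (ι κ : Type*) :=
  κ → ι → ((Γ × (Fin m → ℕ)) →₀ R)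

/-- The coefficients of a bilinear differential(-difference) operator `R^ι × R^κ → R^μ`. -/
abbrev BiOp (m : ℕ) (Γ : Type v) (R : Type u) [CommRing R] (ι κ μ : Type*) :=
  μ → ι → κ → (((Γ × (Fin m → ℕ)) × (Γ × (Fin m → ℕ))) →₀ R)

section Operators

variable {m : ℕ} {Γ : Type v} [Group Γ] {R : Type*} {S : Type*} [CommRing R] [CommRing S]
  [DDRing m Γ S] {ι κ μ : Type*} [Fintype ι] [Fintype κ] [Fintype μ]

/-- The operator with coefficients `A`, over the extension `φ : R → S`:
`A(X)ₖ = ∑ A_{k i θ} θ(Xᵢ)`. -/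
noncomputable def MatOp.app (φ : R →+* S) (A : MatOp m Γ R ι κ) (X : ι → S) : κ → S :=
  fun k => ∑ i, (A k i).sum fun θ c => φ c * act θ (X i)

/-- The operator with coefficients `A`, over the extension `φ : R → S`:
`A(X, Y)ₖ = ∑ A_{k i j θ θ'} θ(Xᵢ) θ'(Yⱼ)`. -/
noncomputable def BiOp.app (φ : R →+* S) (A : BiOp m Γ R ι κ μ) (X : ι → S) (Y : κ → S) : μ → S :=
  fun k => ∑ i, ∑ j, (A k i j).sum fun θ c => φ c * act θ.1 (X i) * act θ.2 (Y j)

/-- The adjoint of `A` in its first argument: `⟨A.trL Y w, X⟩ ∼ ⟨w, A(X, Y)⟩`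
(see `BiOp.trL_pair`). -/
noncomputable def BiOp.trL (φ : R →+* S) (A : BiOp m Γ R ι κ μ) (Y : κ → S) (w : μ → S) : ι → S :=
  fun i => ∑ k, ∑ j, (A k i j).sum fun θ c => adj θ.1 (w k * (φ c * act θ.2 (Y j)))

/-- The adjoint of `A` in its second argument: `⟨A.trR X w, Y⟩ ∼ ⟨w, A(X, Y)⟩`
(see `BiOp.trR_pair`). -/
noncomputable def BiOp.trR (φ : R →+* S) (A : BiOp m Γ R ι κ μ) (X : ι → S) (w : μ → S) : κ → S :=
  fun j => ∑ k, ∑ i, (A k i j).sum fun θ c => adj θ.2 (w k * (φ c * act θ.1 (X i)))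

end Operators

section Adjoints

variable {m : ℕ} {Γ : Type v} [Group Γ] {R : Type u} [CommRing R] [DDRing m Γ R]

theorem Sim.trans {a b c : R} (h : Sim m Γ a b) (h' : Sim m Γ b c) : Sim m Γ a c := by
  have := (trivialElts m Γ R).add_mem h h'
  simpa [Sim] using this

theorem Sim.sum {τ : Type*} (s : Finset τ) {f g : τ → R} (h : ∀ t ∈ s, Sim m Γ (f t) (g t)) :
    Sim m Γ (∑ t ∈ s, f t) (∑ t ∈ s, g t) := by
  have := (trivialElts m Γ R).sum_mem h
  simpa [Sim] using this

theorem sim_der_pow (i : Fin m) (k : ℕ) (a b : R) :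
    Sim m Γ (a * (((der (Γ := Γ) i : Derivation ℤ R R) : Module.End ℤ R) ^ k) b)
      ((-1) ^ k * (((der (Γ := Γ) i : Derivation ℤ R R) : Module.End ℤ R) ^ k) a * b) := by
  induction k generalizing a b with
  | zero => simp [Sim]
  | succ k ih =>
    rw [pow_succ' (M := Module.End ℤ R)]
    refine Sim.trans (b := -(der (Γ := Γ) i a *
      (((der (Γ := Γ) i : Derivation ℤ R R) : Module.End ℤ R) ^ k) b)) ?_ ?_
    · refine AddSubgroup.subset_closure (Or.inl ⟨i,
        a * (((der (Γ := Γ) i : Derivation ℤ R R) : Module.End ℤ R) ^ k) b, ?_⟩)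
      simp [Derivation.leibniz]; ring
    · have := (trivialElts m Γ R).neg_mem (ih (der (Γ := Γ) i a) b)
      rw [← pow_succ' (M := Module.End ℤ R), pow_succ (M := Module.End ℤ R)]
      simp only [Sim, Module.End.mul_apply] at this ⊢
      convert this using 1
      simp only [Derivation.coeFn_coe]
      ring

theorem der_pow_comm (i j : Fin m) (k l : ℕ) :
    Commute (((der (Γ := Γ) i : Derivation ℤ R R) : Module.End ℤ R) ^ k)
      (((der (Γ := Γ) j : Derivation ℤ R R) : Module.End ℤ R) ^ l) := by
  refine Commute.pow_pow ?_ _ _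
  ext a
  exact der_comm i j a

theorem sim_iterDer (σ : Fin m → ℕ) (a b : R) :
    Sim m Γ (a * iterDer Γ σ b) ((-1) ^ (∑ i, σ i) * iterDer Γ σ a * b) := by
  have key : ∀ (l : List (Fin m)) (a b : R),
      Sim m Γ (a * (l.map fun i =>
          ((der (Γ := Γ) i : Derivation ℤ R R) : Module.End ℤ R) ^ σ i).prod b)
        ((-1) ^ (l.map σ).sum * (l.map fun i =>
          ((der (Γ := Γ) i : Derivation ℤ R R) : Module.End ℤ R) ^ σ i).prod a * b) := by
    intro l
    induction l with
    | nil => intro a b; simp [Sim]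
    | cons i l ih =>
      intro a b
      simp only [List.map_cons, List.prod_cons, List.sum_cons, Module.End.mul_apply]
      refine (sim_der_pow i (σ i) a _).trans ?_
      have h := ih ((-1) ^ σ i *
        (((der (Γ := Γ) i : Derivation ℤ R R) : Module.End ℤ R) ^ σ i) a) b
      refine h.trans ?_
      have hc : Commute (((der (Γ := Γ) i : Derivation ℤ R R) : Module.End ℤ R) ^ σ i)
          (l.map fun i => ((der (Γ := Γ) i : Derivation ℤ R R) : Module.End ℤ R) ^ σ i).prod := by
        apply Commute.list_prod_right
        intro x hx
        obtain ⟨j, -, rfl⟩ := List.mem_map.1 hx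
        exact der_pow_comm i j _ _
      have e := LinearMap.congr_fun hc a
      simp only [Module.End.mul_apply] at e
      rw [e]
      have hs : ∀ x : R, (-1 : R) ^ σ i * x = ((-1 : ℤ) ^ σ i) • x := by
        intro x; simp
      rw [hs, map_smul, ← hs, pow_add]
      simp only [Sim]
      convert (trivialElts m Γ R).zero_mem using 1
      ring
  have := key (List.finRange m) a b
  rw [iterDer, List.ofFn_eq_map]
  convert this using 3
  rw [← List.ofFn_eq_map, List.sum_ofFn]

/-- Integration by parts: `adj θ` is the adjoint of `act θ`. -/
theorem sim_act (θ : Γ × (Fin m → ℕ)) (a b : R) :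
    Sim m Γ (a * act θ b) (adj θ a * b) := by
  refine Sim.trans (b := shift m θ.1⁻¹ a * iterDer Γ θ.2 b) ?_ ?_
  · refine AddSubgroup.subset_closure (Or.inr ⟨θ.1, shift m θ.1⁻¹ a * iterDer Γ θ.2 b, ?_⟩)
    simp [act]
  · refine (sim_iterDer θ.2 _ b).trans ?_
    have hd : ∀ (g : Γ) (i : Fin m) (k : ℕ) (x : R),
        (((der (Γ := Γ) i : Derivation ℤ R R) : Module.End ℤ R) ^ k) (shift m g x)
        = shift m g ((((der (Γ := Γ) i : Derivation ℤ R R) : Module.End ℤ R) ^ k) x) := by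
      intro g i k
      induction k with
      | zero => simp
      | succ k ih => intro x; simp [pow_succ, ih, ← shift_der]
    have hl : ∀ (g : Γ) (l : List (Fin m)) (x : R), (l.map fun i =>
          ((der (Γ := Γ) i : Derivation ℤ R R) : Module.End ℤ R) ^ θ.2 i).prod (shift m g x)
        = shift m g ((l.map fun i =>
          ((der (Γ := Γ) i : Derivation ℤ R R) : Module.End ℤ R) ^ θ.2 i).prod x) := by
      intro g l
      induction l with
      | nil => simp
      | cons i l ih => intro x; simp [ih, hd]
    simp only [adj, iterDer, List.ofFn_eq_map, hl]
    simp [Sim]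

variable {Q : Type*} [CommRing Q] {ι κ μ : Type*} [Fintype ι] [Fintype κ] [Fintype μ]

theorem BiOp.trL_pair (φ : Q →+* R) (A : BiOp m Γ Q ι κ μ) (X : ι → R) (Y : κ → R) (w : μ → R) :
    Sim m Γ (pair (A.trL φ Y w) X) (pair w (A.app φ X Y)) := by
  have h : Sim m Γ (pair w (A.app φ X Y)) (pair (A.trL φ Y w) X) := by
    simp only [pair, BiOp.app, BiOp.trL, Finset.mul_sum, Finset.sum_mul, Finsupp.sum]
    rw [Finset.sum_comm]
    refine Sim.sum _ fun i _ => Sim.sum _ fun k _ => Sim.sum _ fun j _ => Sim.sum _ fun θ _ => ?_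
    have := sim_act θ.1 (w k * (φ (A k i j θ) * act θ.2 (Y j))) (X i)
    convert this using 1
    ring
  have := (trivialElts m Γ R).neg_mem h
  simpa [Sim] using this

theorem BiOp.trR_pair (φ : Q →+* R) (A : BiOp m Γ Q ι κ μ) (X : ι → R) (Y : κ → R) (w : μ → R) :
    Sim m Γ (pair (A.trR φ X w) Y) (pair w (A.app φ X Y)) := by
  have h : Sim m Γ (pair w (A.app φ X Y)) (pair (A.trR φ X w) Y) := by
    simp only [pair, BiOp.app, BiOp.trR, Finset.mul_sum, Finset.sum_mul, Finsupp.sum]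
    have e : ∀ f : κ → μ → ι → R, ∑ j, ∑ k, ∑ i, f j k i = ∑ k, ∑ i, ∑ j, f j k i := by
      intro f
      rw [Finset.sum_comm]
      exact Finset.sum_congr rfl fun k _ => Finset.sum_comm
    rw [e fun j k i => ∑ θ ∈ (A k i j).support,
      adj θ.2 (w k * (φ (A k i j θ) * act θ.1 (X i))) * Y j]
    refine Sim.sum _ fun k _ => Sim.sum _ fun i _ => Sim.sum _ fun j _ => Sim.sum _ fun θ _ => ?_
    have := sim_act θ.2 (w k * (φ (A k i j θ) * act θ.1 (X i))) (Y j)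
    convert this using 1
    ring
  have := (trivialElts m Γ R).neg_mem h
  simpa [Sim] using this

end Adjoints

section Algebra

variable {m : ℕ} {Γ : Type v} [Group Γ] {R : Type u} [CommRing R] [DDRing m Γ R] {N n : ℕ}

/-- The bilinear operator `br` makes `R^N` a Lie algebra: skewsymmetry and the Jacobi identity
hold over every extension of `R`. -/
structure IsLie (br : BiOp m Γ R (Fin N) (Fin N) (Fin N)) : Prop where
  skew : ∀ (S : Type (max u v)) [CommRing S] [DDRing m Γ S] (φ : R →+* S), IsExt m Γ φ →
    ∀ X Y : Fin N → S, br.app φ X Y = -br.app φ Y X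
  jacobi : ∀ (S : Type (max u v)) [CommRing S] [DDRing m Γ S] (φ : R →+* S), IsExt m Γ φ →
    ∀ X Y Z : Fin N → S,
      br.app φ (br.app φ X Y) Z + br.app φ (br.app φ Y Z) X + br.app φ (br.app φ Z X) Y = 0

/-- The bilinear operator `χ`, `χ(X, v) = χ(X)(v) = X.v`, is a representation of the Lie algebra
`(R^N, br)` on `V = R^n`, over every extension of `R`. -/
def IsRep (br : BiOp m Γ R (Fin N) (Fin N) (Fin N)) (χ : BiOp m Γ R (Fin N) (Fin n) (Fin n)) :
    Prop :=
  ∀ (S : Type (max u v)) [CommRing S] [DDRing m Γ S] (φ : R →+* S), IsExt m Γ φ →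
    ∀ (X Y : Fin N → S) (w : Fin n → S),
      χ.app φ (br.app φ X Y) w = χ.app φ X (χ.app φ Y w) - χ.app φ Y (χ.app φ X w)

/-- The coadjoint action: `⟨coad X u, Y⟩ ∼ -⟨u, [X, Y]⟩`. -/
noncomputable def coad {S : Type*} [CommRing S] [DDRing m Γ S] (φ : R →+* S)
    (br : BiOp m Γ R (Fin N) (Fin N) (Fin N)) (X u : Fin N → S) : Fin N → S :=
  -br.trR φ X u

/-- `O : 𝒢^* → 𝒢` is an `𝒪`-operator: skewsymmetric, and
`O(O(u)·w - O(w)·u) = [O(u), O(w)]`, over every extension of `R`. -/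
structure IsOOperator (br : BiOp m Γ R (Fin N) (Fin N) (Fin N))
    (O : MatOp m Γ R (Fin N) (Fin N)) : Prop where
  skew : ∀ (S : Type (max u v)) [CommRing S] [DDRing m Γ S] (φ : R →+* S), IsExt m Γ φ →
    ∀ u w : Fin N → S, Sim m Γ (pair u (O.app φ w)) (-pair w (O.app φ u))
  hom : ∀ (S : Type (max u v)) [CommRing S] [DDRing m Γ S] (φ : R →+* S), IsExt m Γ φ →
    ∀ u w : Fin N → S,
      O.app φ (coad φ br (O.app φ u) w - coad φ br (O.app φ w) u)
        = br.app φ (O.app φ u) (O.app φ w)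

/-- The map `∇ : V × V^* → 𝒢^*`, `⟨nabla w p, X⟩ ∼ ⟨p, χ(X)(w)⟩`. -/
noncomputable def nabla {S : Type*} [CommRing S] [DDRing m Γ S] (φ : R →+* S)
    (χ : BiOp m Γ R (Fin N) (Fin n) (Fin n)) (w p : Fin n → S) : Fin N → S :=
  χ.trL φ w p

end Algebra

/-! ### The ring of differential(-difference) polynomials -/

/-- `R[q_i^{(g|σ)}]`, `i ∈ ι`, `g ∈ Γ`, `σ ∈ ℕ^m`. -/
abbrev Jet (m : ℕ) (Γ : Type v) (R : Type u) [CommRing R] (ι : Type) :=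
  MvPolynomial (ι × Γ × (Fin m → ℕ)) R

section Jets

variable {m : ℕ} {Γ : Type v} [Group Γ] {R : Type u} [CommRing R] {ι : Type}

/-- The ring homomorphism `R[τ] → R[τ][ε]`, `ε² = 0`, `a ↦ a + ε d(a)`, `X_t ↦ X_t + ε f t`. -/
noncomputable def polyHom {τ : Type*} (d : Derivation ℤ R R)
    (f : τ → MvPolynomial τ R) : MvPolynomial τ R →+* DualNumber (MvPolynomial τ R) :=
  MvPolynomial.eval₂Hom
    { toFun := fun a =>
        TrivSqZeroExt.inl (MvPolynomial.C a) + TrivSqZeroExt.inr (MvPolynomial.C (d a))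
      map_one' := by ext <;> simp
      map_mul' := fun a b => by ext1 <;> simp [mul_comm]
      map_zero' := by ext <;> simp
      map_add' := fun a b => by ext1 <;> simp }
    (fun t => TrivSqZeroExt.inl (MvPolynomial.X t) + TrivSqZeroExt.inr (f t))

theorem polyHom_fst {τ : Type*} (d : Derivation ℤ R R) (f : τ → MvPolynomial τ R)
    (p : MvPolynomial τ R) : (polyHom d f p).fst = p := by
  induction p using MvPolynomial.induction_on with
  | C a => simp [polyHom]
  | add p q hp hq => simp [hp, hq]
  | mul_X p i hp => simp [hp]; simp [polyHom]

/-- The derivation `D` of `R[τ]` with `D(a) = d(a)` for `a ∈ R` and `D(X_t) = f t`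
(see `polyDer_C`, `polyDer_X`): the `ε`-part of `polyHom`. -/
noncomputable def polyDer {τ : Type*} (d : Derivation ℤ R R)
    (f : τ → MvPolynomial τ R) : Derivation ℤ (MvPolynomial τ R) (MvPolynomial τ R) :=
  Derivation.mk' (AddMonoidHom.toIntLinearMap
    { toFun := fun p => (polyHom d f p).snd
      map_zero' := by simp
      map_add' := fun p q => by simp }) (fun p q => by simp [polyHom_fst, mul_comm])

theorem polyDer_C {τ : Type*} (d : Derivation ℤ R R) (f : τ → MvPolynomial τ R) (a : R) :
    polyDer d f (MvPolynomial.C a) = MvPolynomial.C (d a) := by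
  simp [polyDer, polyHom]

theorem polyDer_X {τ : Type*} (d : Derivation ℤ R R) (f : τ → MvPolynomial τ R) (t : τ) :
    polyDer d f (MvPolynomial.X t) = f t := by
  simp [polyDer, polyHom]

variable [DDRing m Γ R]

/-- The derivation `∂ₗ` of the jet ring: `∂ₗ(q_i^{(g|σ)}) = q_i^{(g|σ + 1ₗ)}`. -/
noncomputable def jetDer (l : Fin m) : Derivation ℤ (Jet m Γ R ι) (Jet m Γ R ι) :=
  polyDer (der (Γ := Γ) l) fun t => MvPolynomial.X (t.1, t.2.1, t.2.2 + Pi.single l 1)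

/-- The homomorphism `ĝ` of the jet ring: `ĝ(q_i^{(h|σ)}) = q_i^{(gh|σ)}`. -/
noncomputable def jetShift (g : Γ) : Jet m Γ R ι →+* Jet m Γ R ι :=
  MvPolynomial.eval₂Hom (MvPolynomial.C.comp (shift (R := R) m g : R →+* R))
    fun t => MvPolynomial.X (t.1, g * t.2.1, t.2.2)

theorem jetShift_one (p : Jet m Γ R ι) : jetShift (m := m) (1 : Γ) p = p := by
  induction p using MvPolynomial.induction_on with
  | C a => simp [jetShift]
  | add p q hp hq => simp [hp, hq]
  | mul_X p i hp => simp [hp]; simp [jetShift]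

theorem jetShift_mul (g h : Γ) (p : Jet m Γ R ι) :
    jetShift (m := m) (g * h) p = jetShift (m := m) g (jetShift (m := m) h p) := by
  induction p using MvPolynomial.induction_on with
  | C a => simp [jetShift]
  | add p q hp hq => simp [hp, hq]
  | mul_X p i hp => simp [hp]; simp [jetShift, mul_assoc]

theorem jetDer_comm (k l : Fin m) (p : Jet m Γ R ι) :
    jetDer k (jetDer l p) = jetDer l (jetDer k p) := by
  induction p using MvPolynomial.induction_on with
  | C a => simp [jetDer, polyDer_C, der_comm k l a]
  | add p q hp hq => simp [hp, hq]
  | mul_X p i hp =>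
    have hX : jetDer k (jetDer l (MvPolynomial.X i : Jet m Γ R ι))
        = jetDer l (jetDer k (MvPolynomial.X i)) := by
      simp [jetDer, polyDer_X, add_right_comm]
    simp only [Derivation.leibniz, map_add, hp, hX, smul_eq_mul]
    ring

theorem jetShift_der (g : Γ) (l : Fin m) (p : Jet m Γ R ι) :
    jetShift (m := m) g (jetDer l p) = jetDer l (jetShift (m := m) g p) := by
  induction p using MvPolynomial.induction_on with
  | C a => simp [jetDer, polyDer_C, jetShift, shift_der]
  | add p q hp hq => simp [hp, hq]
  | mul_X p i hp =>
    have hX : jetShift (m := m) g (jetDer l (MvPolynomial.X i : Jet m Γ R ι))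
        = jetDer l (jetShift (m := m) g (MvPolynomial.X i)) := by
      simp [jetDer, polyDer_X, jetShift]
    simp only [Derivation.leibniz, map_add, map_mul, hp, hX, smul_eq_mul]

/-- The jet ring is a differential-difference extension of `R`. -/
noncomputable instance instJet : DDRing m Γ (Jet m Γ R ι) where
  der := jetDer
  shift :=
    { toFun := fun g => RingEquiv.ofRingHom (jetShift (m := m) g) (jetShift (m := m) g⁻¹)
        (RingHom.ext fun p => by simp [← jetShift_mul, jetShift_one])
        (RingHom.ext fun p => by simp [← jetShift_mul, jetShift_one])
      map_one' := RingEquiv.ext fun p => jetShift_one p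
      map_mul' := fun g h => RingEquiv.ext fun p => jetShift_mul g h p }
  der_comm := jetDer_comm
  shift_der := jetShift_der

/-- The variational derivative `δH/δq_i = ∑_{g,σ} ĝ⁻¹ (-∂)^σ (∂H/∂q_i^{(g|σ)})`
(a sum with finitely many non-zero terms). -/
noncomputable def varDer (H : Jet m Γ R ι) (i : ι) : Jet m Γ R ι :=
  ∑ᶠ θ : Γ × (Fin m → ℕ), adj θ (MvPolynomial.pderiv (i, θ) H)

/-- `br` is (a choice of representatives, modulo `∼`, of) a Poisson bracket on the ring of
differential(-difference) polynomials `C`: it is given by a matrix `B` of differential(-difference)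
operators over `C`, `{H, F} ∼ (δF/δq)ᵗ B(δH/δq)`, it is skewsymmetric and satisfies the Jacobi
identity, modulo `∼`. -/
structure IsPoisson [Fintype ι] (br : Jet m Γ R ι → Jet m Γ R ι → Jet m Γ R ι) : Prop where
  hamiltonian : ∃ B : MatOp m Γ (Jet m Γ R ι) ι ι, ∀ H F : Jet m Γ R ι,
    Sim m Γ (br H F) (pair (varDer F) (B.app (RingHom.id _) (varDer H)))
  skew : ∀ H F : Jet m Γ R ι, Sim m Γ (br H F) (-br F H)
  jacobi : ∀ H F G : Jet m Γ R ι,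
    Sim m Γ (br (br H F) G + br (br F G) H + br (br G H) F) 0

/-- Two brackets are compatible: every linear combination of them with constant coefficients
is a Poisson bracket. -/
def Compatible [Fintype ι] (br₁ br₂ : Jet m Γ R ι → Jet m Γ R ι → Jet m Γ R ι) : Prop :=
  ∀ a b : R, IsConst m Γ a → IsConst m Γ b →
    IsPoisson fun H F => MvPolynomial.C a * br₁ H F + MvPolynomial.C b * br₂ H F

end Jets

section Phase

variable {m : ℕ} {Γ : Type v} [Group Γ] {R : Type u} [CommRing R] [DDRing m Γ R] {N n : ℕ}

/-- `C = Fun(V ⊕ V^*) = R[x_α^{(g|σ)}, p_α^{(g|σ)}]`, for `V = R^n`. -/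
abbrev Phase (m : ℕ) (Γ : Type v) (R : Type u) [CommRing R] (n : ℕ) :=
  Jet m Γ R (Fin n ⊕ Fin n)

/-- The vector `𝐱` of generators. -/
noncomputable def vx : Fin n → Phase m Γ R n := fun i => MvPolynomial.X (Sum.inl i, 1, 0)

/-- The vector `𝐩` of generators. -/
noncomputable def vp : Fin n → Phase m Γ R n := fun i => MvPolynomial.X (Sum.inr i, 1, 0)

/-- `δH/δ𝐱`. -/
noncomputable def dx (H : Phase m Γ R n) : Fin n → Phase m Γ R n := fun i => varDer H (Sum.inl i)

/-- `δH/δ𝐩`. -/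
noncomputable def dp (H : Phase m Γ R n) : Fin n → Phase m Γ R n := fun i => varDer H (Sum.inr i)

/-- The symplectic bracket `{H, F} ∼ -(δF/δ𝐱)ᵗ (δH/δ𝐩) + (δF/δ𝐩)ᵗ (δH/δ𝐱)`. -/
noncomputable def symplecticBracket (H F : Phase m Γ R n) : Phase m Γ R n :=
  -pair (dx F) (dp H) + pair (dp F) (dx H)

/-- The quadratic bracket `{H, F} ∼ ∑ 𝐍ᵗ B(𝐌)`, with `𝐌` running over the components `δH/δ𝐱`,
`δH/δ𝐩`, and `𝐍` over the components `δF/δ𝐱`, `δF/δ𝐩`, where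
`𝐍ᵗ B_xx(𝐌) ∼ ⟨𝐱 ∇ 𝐌, O(𝐱 ∇ 𝐍)⟩`, `𝐍ᵗ B_xp(𝐌) ∼ -⟨𝐌 ∇ 𝐩, O(𝐱 ∇ 𝐍)⟩`,
`𝐍ᵗ B_px(𝐌) ∼ -⟨𝐱 ∇ 𝐌, O(𝐍 ∇ 𝐩)⟩`, `𝐍ᵗ B_pp(𝐌) ∼ ⟨𝐌 ∇ 𝐩, O(𝐍 ∇ 𝐩)⟩`. -/
noncomputable def quadraticBracket (χ : BiOp m Γ R (Fin N) (Fin n) (Fin n))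
    (O : MatOp m Γ R (Fin N) (Fin N)) (H F : Phase m Γ R n) : Phase m Γ R n :=
  pair (nabla MvPolynomial.C χ vx (dx H)) (O.app MvPolynomial.C (nabla MvPolynomial.C χ vx (dx F)))
  - pair (nabla MvPolynomial.C χ (dp H) vp)
      (O.app MvPolynomial.C (nabla MvPolynomial.C χ vx (dx F)))
  - pair (nabla MvPolynomial.C χ vx (dx H))
      (O.app MvPolynomial.C (nabla MvPolynomial.C χ (dp F) vp))
  + pair (nabla MvPolynomial.C χ (dp H) vp)
      (O.app MvPolynomial.C (nabla MvPolynomial.C χ (dp F) vp))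

end Phase

end DDRing

/-! Each bracket is a form ω(δH, δF) ∼ ⟨δF, B(δH)⟩ on pairs of covectors. Expanding the Jacobi sum
along the evolutionary fields B(δG) gives terms with derivatives of δH, δF, δG and terms with
derivatives of the coefficients of ω. The former cancel in pairs because the second variation is
symmetric (`sim_evol_varDer`). What remains is the cyclic sum of dω(B L)(M, N), a Schouten bracket
evaluated on arbitrary covectors (`sim_jacobi_of_cyclic`).

The symplectic form has constant coefficients, so dω comes from the quadratic form alone. That form
is ⟨u(M), O(u(N))⟩ with u(M) = x∇M_x - M_p∇p: it is O, seen as a triangular r-matrix, transported to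
V ⊕ V* by the linear action of 𝒢. For the pencil with constants a, b the operator is aJ + bQ, and
the cyclic sum has two parts.

The ab part vanishes since 𝒢 acts on V ⊕ V* by infinitesimally symplectic maps: pairing a covector M
with the action of Y on JL is symmetric in L and M (`actPair_sympOp`).

The b² part becomes, by the representation property (`sim_momentum_bracket`), minus the cyclic sum
of ⟨u(L), [O u(M), O u(N)]⟩. This is trivial by the Yang-Baxter identity (`IsOOperator.sim_cyclic`).

Both parts are handled together in `sim_quadFormDeriv_cyclic`. -/

namespace DDRing

/-! ### Calculus modulo ∼, iterated operators, and the pairing. -/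

section Basic

variable {m : ℕ} {Γ : Type v} [Group Γ] {R : Type u} [CommRing R] [DDRing m Γ R]

/-- Passing to the quotient group turns ∼ into equality, so that combinations of such relations can
be closed by additive normalisation. -/
theorem sim_iff {a b : R} :
    Sim m Γ a b ↔ (a : R ⧸ trivialElts m Γ R) = (b : R ⧸ trivialElts m Γ R) := by
  rw [Sim, QuotientAddGroup.eq_iff_sub_mem]

theorem Sim.symm {a b : R} (h : Sim m Γ a b) : Sim m Γ b a := sim_iff.2 (sim_iff.1 h).symm

theorem Sim.of_eq {a b : R} (h : a = b) : Sim m Γ a b := sim_iff.2 (by rw [h])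

theorem Sim.add {a b c d : R} (h : Sim m Γ a b) (h' : Sim m Γ c d) :
    Sim m Γ (a + c) (b + d) := by
  rw [sim_iff] at *
  rw [QuotientAddGroup.mk_add, h, h', ← QuotientAddGroup.mk_add]

theorem Sim.neg {a b : R} (h : Sim m Γ a b) : Sim m Γ (-a) (-b) := by
  rw [sim_iff] at *
  rw [QuotientAddGroup.mk_neg, h, ← QuotientAddGroup.mk_neg]

theorem Sim.sub {a b c d : R} (h : Sim m Γ a b) (h' : Sim m Γ c d) :
    Sim m Γ (a - c) (b - d) := by
  simpa only [sub_eq_add_neg] using h.add h'.neg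

/-- An additive map commuting with derivations and shifts respects `∼`. -/
theorem Sim.map (E : R →+ R) (hd : ∀ (i : Fin m) x, E (der (Γ := Γ) i x) = der (Γ := Γ) i (E x))
    (hs : ∀ (g : Γ) x, E (shift m g x) = shift m g (E x)) {a b : R} (h : Sim m Γ a b) :
    Sim m Γ (E a) (E b) := by
  rw [Sim, ← map_sub]
  have : trivialElts m Γ R ≤ (trivialElts m Γ R).comap E := by
    refine (AddSubgroup.closure_le _).2 ?_
    rintro x (⟨i, y, rfl⟩ | ⟨g, y, rfl⟩)
    · exact AddSubgroup.subset_closure (Or.inl ⟨i, E y, hd i y⟩)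
    · exact AddSubgroup.subset_closure (Or.inr ⟨g, E y, by rw [map_sub, hs]⟩)
  exact this h

/-- Trivial elements do not form an ideal, but multiplication by a constant commutes with every ∂
and every shift, and so preserves them. -/
theorem IsConst.sim_mul {c a b : R} (hc : IsConst m Γ c) (h : Sim m Γ a b) :
    Sim m Γ (c * a) (c * b) :=
  h.map (AddMonoidHom.mulLeft c) (fun i x => by simp [hc.1 i]) (fun g x => by simp [hc.2 g])

/-- A `ℤ`-linear map commuting with all derivations commutes with `∂^σ`. -/
theorem commute_iterDer (E : Module.End ℤ R)
    (hd : ∀ (i : Fin m) x, E (der (Γ := Γ) i x) = der (Γ := Γ) i (E x)) (σ : Fin m → ℕ) (x : R) :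
    E (iterDer Γ σ x) = iterDer Γ σ (E x) := by
  have : Commute E (iterDer Γ σ) := by
    refine Commute.list_prod_right _ _ fun y hy => ?_
    obtain ⟨i, rfl⟩ := (List.mem_ofFn' _ _).1 hy
    exact Commute.pow_right (LinearMap.ext fun x => hd i x) _
  exact LinearMap.congr_fun this x

theorem commute_act (E : Module.End ℤ R)
    (hd : ∀ (i : Fin m) x, E (der (Γ := Γ) i x) = der (Γ := Γ) i (E x))
    (hs : ∀ (g : Γ) x, E (shift m g x) = shift m g (E x)) (θ : Γ × (Fin m → ℕ)) (x : R) :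
    E (act θ x) = act θ (E x) := by
  rw [act, hs, commute_iterDer E hd, act]

theorem shift_act (g : Γ) (θ : Γ × (Fin m → ℕ)) (x : R) :
    shift m g (act θ x) = act (g * θ.1, θ.2) x := by
  simp [act]

/-- In an ordered product of powers, the extra factor is moved to the front by commutativity. This
is what makes ∂ₗ ∂^σ equal to ∂^(σ + 1ₗ). -/
theorem prod_ofFn_pow_add_single {M : Type*} [Monoid M] {k : ℕ} (x : Fin k → M)
    (hx : ∀ i j, Commute (x i) (x j)) (σ : Fin k → ℕ) (l : Fin k) :
    (List.ofFn fun i => x i ^ (σ + Pi.single l 1 : Fin k → ℕ) i).prod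
      = x l * (List.ofFn fun i => x i ^ σ i).prod := by
  induction k with
  | zero => exact l.elim0
  | succ k ih =>
    rw [List.ofFn_succ, List.ofFn_succ, List.prod_cons, List.prod_cons]
    refine Fin.cases ?_ (fun l => ?_) l
    · simp [pow_succ', mul_assoc]
    · have h := ih (fun i => x i.succ) (fun i j => hx _ _) (fun i => σ i.succ) l
      have e : ∀ i : Fin k, (Pi.single l.succ 1 : Fin (k + 1) → ℕ) i.succ
          = (Pi.single l 1 : Fin k → ℕ) i := fun i => by
        simp [Pi.single_apply]
      simp only [Pi.add_apply, e] at h ⊢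
      rw [h, Pi.single_eq_of_ne (Fin.succ_ne_zero l).symm, add_zero, ← mul_assoc, ← mul_assoc,
        ((hx 0 l.succ).pow_left _).eq]

theorem der_act (l : Fin m) (θ : Γ × (Fin m → ℕ)) (x : R) :
    der (Γ := Γ) l (act θ x) = act (θ.1, θ.2 + Pi.single l 1) x := by
  rw [act, ← shift_der, act, iterDer, iterDer, prod_ofFn_pow_add_single]
  · rfl
  · intro i j
    ext a
    exact der_comm i j a

theorem act_add (θ : Γ × (Fin m → ℕ)) (x y : R) : act θ (x + y) = act θ x + act θ y := by
  simp [act]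

theorem act_neg (θ : Γ × (Fin m → ℕ)) (x : R) : act θ (-x) = -act θ x := by
  simp [act]

theorem act_one_zero (x : R) : act ((1, 0) : Γ × (Fin m → ℕ)) x = x := by
  simp [act, iterDer]

theorem adj_eq (θ : Γ × (Fin m → ℕ)) (x : R) :
    adj θ x = (-1) ^ (∑ i, θ.2 i) * act (θ.1⁻¹, θ.2) x := rfl

theorem adj_add (θ : Γ × (Fin m → ℕ)) (x y : R) : adj θ (x + y) = adj θ x + adj θ y := by
  rw [adj_eq, adj_eq, adj_eq, act_add, mul_add]

theorem adj_zero (θ : Γ × (Fin m → ℕ)) : adj θ (0 : R) = 0 := by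
  simp [adj]

theorem IsConst.act_mul {c : R} (hc : IsConst m Γ c) (θ : Γ × (Fin m → ℕ)) (x : R) :
    act θ (c * x) = c * act θ x :=
  (commute_act (LinearMap.mulLeft ℤ c) (fun i x => by simp [hc.1 i])
    (fun g x => by simp [hc.2 g]) θ x).symm

section Pair

variable {κ : Type*} [Fintype κ]

theorem pair_comm (u w : κ → R) : pair u w = pair w u := by
  simp only [pair, mul_comm]

theorem pair_add (u w w' : κ → R) : pair u (w + w') = pair u w + pair u w' := by
  simp [pair, mul_add, Finset.sum_add_distrib]

theorem add_pair (u u' w : κ → R) : pair (u + u') w = pair u w + pair u' w := by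
  simp [pair, add_mul, Finset.sum_add_distrib]

theorem pair_neg (u w : κ → R) : pair u (-w) = -pair u w := by
  simp [pair]

theorem neg_pair (u w : κ → R) : pair (-u) w = -pair u w := by
  simp [pair]

theorem pair_sub (u w w' : κ → R) : pair u (w - w') = pair u w - pair u w' := by
  rw [sub_eq_add_neg, pair_add, pair_neg, ← sub_eq_add_neg]

theorem sub_pair (u u' w : κ → R) : pair (u - u') w = pair u w - pair u' w := by
  rw [sub_eq_add_neg, add_pair, neg_pair, ← sub_eq_add_neg]

theorem pair_smul (c : R) (u w : κ → R) : pair u (c • w) = c * pair u w := by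
  simp [pair, Finset.mul_sum, mul_left_comm]

theorem smul_pair (c : R) (u w : κ → R) : pair (c • u) w = c * pair u w := by
  simp [pair, Finset.mul_sum, mul_assoc]

theorem pair_sum_type {κ' : Type*} [Fintype κ'] (u w : κ ⊕ κ' → R) :
    pair u w = pair (u ∘ Sum.inl) (w ∘ Sum.inl) + pair (u ∘ Sum.inr) (w ∘ Sum.inr) := by
  simp [pair, Fintype.sum_sum_type]

end Pair

end Basic

/-! ### Linearity and Leibniz rules for operators and adjoints. -/

section OperatorLinearity

variable {m : ℕ} {Γ : Type v} [Group Γ] {R S : Type*} [CommRing R] [CommRing S]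
  [DDRing m Γ S] {ι κ μ : Type*} (φ : R →+* S)

theorem MatOp.app_add [Fintype ι] (A : MatOp m Γ R ι κ) (X Y : ι → S) :
    A.app φ (X + Y) = A.app φ X + A.app φ Y := by
  ext k
  simp [MatOp.app, act_add, mul_add, Finset.sum_add_distrib, Finsupp.sum]

theorem MatOp.app_neg [Fintype ι] (A : MatOp m Γ R ι κ) (X : ι → S) :
    A.app φ (-X) = -A.app φ X := by
  ext k
  simp [MatOp.app, act_neg, Finsupp.sum]

theorem MatOp.app_sub [Fintype ι] (A : MatOp m Γ R ι κ) (X Y : ι → S) :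
    A.app φ (X - Y) = A.app φ X - A.app φ Y := by
  rw [sub_eq_add_neg, app_add, app_neg, ← sub_eq_add_neg]

theorem BiOp.app_add_right [Fintype ι] [Fintype κ]
    (A : BiOp m Γ R ι κ μ) (X : ι → S) (Y Y' : κ → S) :
    A.app φ X (Y + Y') = A.app φ X Y + A.app φ X Y' := by
  ext k
  simp [BiOp.app, act_add, mul_add, Finset.sum_add_distrib, Finsupp.sum]

theorem BiOp.app_neg_right [Fintype ι] [Fintype κ] (A : BiOp m Γ R ι κ μ) (X : ι → S) (Y : κ → S) :
    A.app φ X (-Y) = -A.app φ X Y := by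
  ext k
  simp [BiOp.app, act_neg, Finsupp.sum]

theorem BiOp.app_smul_right [Fintype ι] [Fintype κ]
    (A : BiOp m Γ R ι κ μ) {c : S} (hc : IsConst m Γ c) (X : ι → S)
    (Y : κ → S) : A.app φ X (c • Y) = c • A.app φ X Y := by
  ext k
  simp [BiOp.app, hc.act_mul, Finsupp.sum, Finset.mul_sum, mul_left_comm]

/-- Leibniz rule for the first adjoint of a bilinear operator with respect to a derivation which
kills the coefficients. -/
theorem BiOp.trL_derivation [Fintype κ] [Fintype μ] (E : Derivation ℤ S S)
    (hd : ∀ (i : Fin m) x, E (der (Γ := Γ) i x) = der (Γ := Γ) i (E x))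
    (hs : ∀ (g : Γ) x, E (shift m g x) = shift m g (E x)) (hφ : ∀ a, E (φ a) = 0)
    (A : BiOp m Γ R ι κ μ) (Y : κ → S) (w : μ → S) :
    E ∘ A.trL φ Y w = A.trL φ (E ∘ Y) w + A.trL φ Y (E ∘ w) := by
  have ha : ∀ (θ : Γ × (Fin m → ℕ)) x, E (act θ x) = act θ (E x) :=
    commute_act (E : Module.End ℤ S) hd hs
  have hj : ∀ (θ : Γ × (Fin m → ℕ)) x, E (adj θ x) = adj θ (E x) := fun θ x => by
    rw [adj_eq, adj_eq, ← ha, E.leibniz]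
    have : E ((-1) ^ (∑ i, θ.2 i)) = 0 := by
      -- The sign is the image of an integer, and a ℤ-derivation kills integers.
      simpa only [map_pow, map_neg, map_one] using E.map_algebraMap ((-1) ^ (∑ i, θ.2 i))
    simp [this]
  ext i
  simp only [Function.comp_apply, Pi.add_apply, BiOp.trL, Finsupp.sum, map_sum, hj,
    ← Finset.sum_add_distrib, ← adj_add]
  refine Finset.sum_congr rfl fun k _ => Finset.sum_congr rfl fun j _ =>
    Finset.sum_congr rfl fun θ _ => ?_
  simp only [E.leibniz, hφ, ha, smul_eq_mul]
  congr 1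
  ring

theorem MatOp.app_derivation [Fintype ι] (E : Derivation ℤ S S)
    (hd : ∀ (i : Fin m) x, E (der (Γ := Γ) i x) = der (Γ := Γ) i (E x))
    (hs : ∀ (g : Γ) x, E (shift m g x) = shift m g (E x)) (hφ : ∀ a, E (φ a) = 0)
    (A : MatOp m Γ R ι κ) (X : ι → S) : E ∘ A.app φ X = A.app φ (E ∘ X) := by
  have ha : ∀ (θ : Γ × (Fin m → ℕ)) x, E (act θ x) = act θ (E x) :=
    commute_act (E : Module.End ℤ S) hd hs
  ext k
  simp [MatOp.app, Finsupp.sum, hφ, ha]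

end OperatorLinearity

/-! ### Closure properties of differential operators, and their matrices. -/

section DiffOps

variable (m : ℕ) (Γ : Type v) [Group Γ] (S : Type*) [CommRing S] [DDRing m Γ S] (ι : Type*)

/-- The `S`-module of scalar-valued differential operators `S^ι → S`. -/
def diffOps : Submodule S ((ι → S) → S) :=
  Submodule.span S
    (Set.range fun t : ι × Γ × (Fin m → ℕ) => fun X : ι → S => act t.2 (X t.1))

variable {m Γ S ι}

theorem proj_mem_diffOps (i : ι) : (fun X : ι → S => X i) ∈ diffOps m Γ S ι :=
  Submodule.subset_span ⟨(i, 1, 0), funext fun _ => act_one_zero _⟩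

theorem mul_mem_diffOps (c : S) {f : (ι → S) → S} (hf : f ∈ diffOps m Γ S ι) :
    (fun X => c * f X) ∈ diffOps m Γ S ι :=
  Submodule.smul_mem _ c hf

theorem der_mem_diffOps (l : Fin m) {f : (ι → S) → S} (hf : f ∈ diffOps m Γ S ι) :
    (fun X => der (Γ := Γ) l (f X)) ∈ diffOps m Γ S ι := by
  induction hf using Submodule.span_induction with
  | mem f hf =>
    obtain ⟨t, rfl⟩ := hf
    exact Submodule.subset_span ⟨(t.1, t.2.1, t.2.2 + Pi.single l 1), funext fun X =>
      (der_act l t.2 (X t.1)).symm⟩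
  | zero =>
    convert Submodule.zero_mem (diffOps m Γ S ι) using 1
    funext X
    simp
  | add f g _ _ hf hg =>
    convert Submodule.add_mem _ hf hg using 1
    funext X
    simp
  | smul c f hf h =>
    -- Leibniz: ∂(c f) = c ∂f + (∂c) f.
    have := Submodule.add_mem _ (mul_mem_diffOps c h) (mul_mem_diffOps (der (Γ := Γ) l c) hf)
    convert this using 1
    funext X
    simp [mul_comm]

theorem shift_mem_diffOps (g : Γ) {f : (ι → S) → S} (hf : f ∈ diffOps m Γ S ι) :
    (fun X => shift m g (f X)) ∈ diffOps m Γ S ι := by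
  induction hf using Submodule.span_induction with
  | mem f hf =>
    obtain ⟨t, rfl⟩ := hf
    exact Submodule.subset_span ⟨(t.1, g * t.2.1, t.2.2), funext fun X =>
      (shift_act g t.2 (X t.1)).symm⟩
  | zero =>
    convert Submodule.zero_mem (diffOps m Γ S ι) using 1
    funext X
    simp
  | add f g _ _ hf hg =>
    convert Submodule.add_mem _ hf hg using 1
    funext X
    simp
  | smul c f hf h => simpa using mul_mem_diffOps (shift m g c) h

theorem act_mem_diffOps (θ : Γ × (Fin m → ℕ)) {f : (ι → S) → S} (hf : f ∈ diffOps m Γ S ι) :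
    (fun X => act θ (f X)) ∈ diffOps m Γ S ι := by
  refine shift_mem_diffOps θ.1 (f := fun X => iterDer Γ θ.2 (f X)) ?_
  -- Endomorphisms that preserve differential operators under composition form a monoid, so it
  -- suffices to treat the single derivations of which ∂^σ is a product.
  let P : Submonoid (Module.End ℤ S) :=
    { carrier := {T | ∀ f ∈ diffOps m Γ S ι, (fun X => T (f X)) ∈ diffOps m Γ S ι}
      one_mem' := fun f hf => hf
      mul_mem' := fun hT hU f hf => hT _ (hU f hf) }
  have : iterDer Γ θ.2 ∈ P := by
    refine Submonoid.list_prod_mem _ fun y hy => ?_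
    obtain ⟨i, rfl⟩ := (List.mem_ofFn' _ _).1 hy
    exact P.pow_mem (fun f hf => der_mem_diffOps i hf) _
  exact this f hf

theorem adj_mem_diffOps (θ : Γ × (Fin m → ℕ)) {f : (ι → S) → S} (hf : f ∈ diffOps m Γ S ι) :
    (fun X => adj θ (f X)) ∈ diffOps m Γ S ι :=
  mul_mem_diffOps _ (act_mem_diffOps (θ.1⁻¹, θ.2) hf)

theorem sum_mem_diffOps {τ : Type*} (s : Finset τ) {f : τ → (ι → S) → S}
    (hf : ∀ t ∈ s, f t ∈ diffOps m Γ S ι) : (fun X => ∑ t ∈ s, f t X) ∈ diffOps m Γ S ι := by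
  convert Submodule.sum_mem _ hf using 1
  funext X
  simp

section

variable {R : Type*} [CommRing R] (φ : R →+* S) {α β γ : Type*}

theorem MatOp.app_mem_diffOps [Fintype α] (A : MatOp m Γ R α β) {f : (ι → S) → α → S}
    (hf : ∀ a, (fun X => f X a) ∈ diffOps m Γ S ι) (b : β) :
    (fun X => A.app φ (f X) b) ∈ diffOps m Γ S ι :=
  sum_mem_diffOps _ fun _ _ => sum_mem_diffOps _ fun _ _ =>
    mul_mem_diffOps _ (act_mem_diffOps _ (hf _))

theorem BiOp.app_mem_diffOps [Fintype α] [Fintype β] (A : BiOp m Γ R α β γ) {f : (ι → S) → α → S}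
    (hf : ∀ a, (fun X => f X a) ∈ diffOps m Γ S ι) (Y : β → S) (c : γ) :
    (fun X => A.app φ (f X) Y c) ∈ diffOps m Γ S ι := by
  refine sum_mem_diffOps _ fun i _ => sum_mem_diffOps _ fun j _ => sum_mem_diffOps _ fun θ _ => ?_
  convert mul_mem_diffOps (φ (A c i j θ) * act θ.2 (Y j)) (act_mem_diffOps θ.1 (hf i)) using 2
  ring

theorem BiOp.trL_mem_diffOps_left [Fintype β] [Fintype γ]
    (A : BiOp m Γ R α β γ) {f : (ι → S) → β → S}
    (hf : ∀ b, (fun X => f X b) ∈ diffOps m Γ S ι) (w : γ → S) (a : α) :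
    (fun X => A.trL φ (f X) w a) ∈ diffOps m Γ S ι :=
  sum_mem_diffOps _ fun _ _ => sum_mem_diffOps _ fun _ _ => sum_mem_diffOps _ fun _ _ =>
    adj_mem_diffOps _ (mul_mem_diffOps _ (mul_mem_diffOps _ (act_mem_diffOps _ (hf _))))

theorem BiOp.trL_mem_diffOps_right [Fintype β] [Fintype γ]
    (A : BiOp m Γ R α β γ) (Y : β → S) {f : (ι → S) → γ → S}
    (hf : ∀ c, (fun X => f X c) ∈ diffOps m Γ S ι) (a : α) :
    (fun X => A.trL φ Y (f X) a) ∈ diffOps m Γ S ι := by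
  refine sum_mem_diffOps _ fun k _ => sum_mem_diffOps _ fun j _ => sum_mem_diffOps _ fun θ _ =>
    adj_mem_diffOps _ ?_
  simp only [mul_comm _ (φ _ * _)]
  exact mul_mem_diffOps _ (hf k)

theorem BiOp.trR_mem_diffOps [Fintype α] [Fintype γ] (A : BiOp m Γ R α β γ) {f : (ι → S) → α → S}
    (hf : ∀ a, (fun X => f X a) ∈ diffOps m Γ S ι) (w : γ → S) (b : β) :
    (fun X => A.trR φ (f X) w b) ∈ diffOps m Γ S ι :=
  sum_mem_diffOps _ fun _ _ => sum_mem_diffOps _ fun _ _ => sum_mem_diffOps _ fun _ _ =>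
    adj_mem_diffOps _ (mul_mem_diffOps _ (mul_mem_diffOps _ (act_mem_diffOps _ (hf _))))

end

theorem exists_coeff_of_mem_diffOps [Fintype ι] {f : (ι → S) → S}
    (hf : f ∈ diffOps m Γ S ι) :
    ∃ A : ι → (Γ × (Fin m → ℕ)) →₀ S,
      ∀ X, f X = ∑ i, (A i).sum fun θ c => c * act θ (X i) := by
  classical
  induction hf using Submodule.span_induction with
  | mem f hf =>
    obtain ⟨t, rfl⟩ := hf
    refine ⟨Pi.single t.1 (Finsupp.single t.2 1), fun X => ?_⟩
    rw [Finset.sum_eq_single t.1]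
    · simp
    · intro i _ hi
      simp [Pi.single_eq_of_ne hi]
    · simp
  | zero => exact ⟨0, by simp⟩
  | add f g _ _ hf hg =>
    obtain ⟨A, hA⟩ := hf
    obtain ⟨B, hB⟩ := hg
    refine ⟨A + B, fun X => ?_⟩
    simp only [Pi.add_apply, hA, hB, ← Finset.sum_add_distrib]
    refine Finset.sum_congr rfl fun i _ => (Finsupp.sum_add_index' ?_ ?_).symm <;> intros <;> ring
  | smul c f _ hf =>
    obtain ⟨A, hA⟩ := hf
    refine ⟨c • A, fun X => ?_⟩
    simp only [Pi.smul_apply, hA, Finset.smul_sum]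
    refine Finset.sum_congr rfl fun i _ => ?_
    rw [Finsupp.sum_smul_index' (by simp), Finsupp.smul_sum]
    simp [mul_assoc]

/-- Operators whose components are differential operators are given by matrices. -/
theorem exists_matOp [Fintype ι] {κ : Type*} {f : (ι → S) → κ → S}
    (hf : ∀ k, (fun X => f X k) ∈ diffOps m Γ S ι) :
    ∃ A : MatOp m Γ S ι κ, ∀ X, A.app (RingHom.id S) X = f X := by
  choose A hA using fun k => exists_coeff_of_mem_diffOps (hf k)
  exact ⟨A, fun X => funext fun k => (hA k X).symm⟩

end DiffOps


/-! ### Evolutionary derivations, variational derivatives, and the Jacobi identity. -/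

section Evolution

variable {m : ℕ} {Γ : Type v} [Group Γ] {R : Type u} [CommRing R] [DDRing m Γ R] {ι : Type}

/-- This allows the identities assumed over all extensions of R to be used on the jet ring. -/
theorem isExt_C : IsExt m Γ (MvPolynomial.C : R →+* Jet m Γ R ι) where
  inj := MvPolynomial.C_injective _ _
  map_der _ a := (polyDer_C _ _ a).symm
  map_shift g a :=
    (MvPolynomial.eval₂Hom_C (MvPolynomial.C.comp (shift (R := R) m g : R →+* R)) _ a).symm

theorem IsConst.C {a : R} (ha : IsConst m Γ a) :
    IsConst m Γ (MvPolynomial.C a : Jet m Γ R ι) :=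
  ⟨fun i => by rw [← isExt_C.map_der, ha.1, map_zero],
    fun g => by rw [← isExt_C.map_shift, ha.2]⟩

theorem der_X (l : Fin m) (t : ι × Γ × (Fin m → ℕ)) :
    der (Γ := Γ) l (MvPolynomial.X t : Jet m Γ R ι)
      = MvPolynomial.X (t.1, t.2.1, t.2.2 + Pi.single l 1) :=
  polyDer_X _ _ t

theorem shift_X (g : Γ) (t : ι × Γ × (Fin m → ℕ)) :
    shift m g (MvPolynomial.X t : Jet m Γ R ι) = MvPolynomial.X (t.1, g * t.2.1, t.2.2) :=
  MvPolynomial.eval₂Hom_X' _ _ t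

/-- The evolutionary derivation of the jet ring with characteristic `ξ`: it kills `R`, commutes
with the derivations and the shifts, and takes `q_i` to `ξ_i`. -/
noncomputable def evol (ξ : ι → Jet m Γ R ι) : Derivation R (Jet m Γ R ι) (Jet m Γ R ι) :=
  MvPolynomial.mkDerivation R fun t => act t.2 (ξ t.1)

theorem evol_C (ξ : ι → Jet m Γ R ι) (a : R) : evol ξ (MvPolynomial.C a) = 0 :=
  (evol ξ).map_algebraMap a

theorem evol_X (ξ : ι → Jet m Γ R ι) (t : ι × Γ × (Fin m → ℕ)) :
    evol ξ (MvPolynomial.X t) = act t.2 (ξ t.1) :=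
  MvPolynomial.mkDerivation_X _ _ _

theorem evol_gen (ξ : ι → Jet m Γ R ι) (i : ι) :
    evol ξ (MvPolynomial.X (i, 1, 0)) = ξ i := by
  rw [evol_X, act_one_zero]

theorem evol_der (ξ : ι → Jet m Γ R ι) (l : Fin m) (p : Jet m Γ R ι) :
    evol ξ (der (Γ := Γ) l p) = der (Γ := Γ) l (evol ξ p) := by
  induction p using MvPolynomial.induction_on with
  | C a => rw [← isExt_C.map_der, evol_C, evol_C, map_zero]
  | add p q hp hq => simp only [map_add, hp, hq]
  | mul_X p t hp =>
    have hX : evol ξ (der (Γ := Γ) l (MvPolynomial.X t))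
        = der (Γ := Γ) l (evol ξ (MvPolynomial.X t)) := by
      rw [der_X, evol_X, evol_X, der_act]
    simp only [Derivation.leibniz, map_add, hp, hX, smul_eq_mul]
    ring

theorem evol_shift (ξ : ι → Jet m Γ R ι) (g : Γ) (p : Jet m Γ R ι) :
    evol ξ (shift m g p) = shift m g (evol ξ p) := by
  induction p using MvPolynomial.induction_on with
  | C a => rw [← isExt_C.map_shift, evol_C, evol_C, map_zero]
  | add p q hp hq => simp only [map_add, hp, hq]
  | mul_X p t hp =>
    have hX : evol ξ (shift m g (MvPolynomial.X t)) = shift m g (evol ξ (MvPolynomial.X t)) := by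
      rw [shift_X, evol_X, evol_X, shift_act]
    simp only [Derivation.leibniz, map_add, map_mul, hp, hX, smul_eq_mul]

theorem Sim.evol {p q : Jet m Γ R ι} (h : Sim m Γ p q) (ξ : ι → Jet m Γ R ι) :
    Sim m Γ (evol ξ p) (DDRing.evol ξ q) :=
  Sim.map (DDRing.evol ξ : Jet m Γ R ι →ₗ[R] Jet m Γ R ι).toAddMonoidHom (evol_der ξ)
    (evol_shift ξ) h

theorem evol_act (ξ : ι → Jet m Γ R ι) (θ : Γ × (Fin m → ℕ)) (p : Jet m Γ R ι) :
    evol ξ (act θ p) = act θ (evol ξ p) :=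
  commute_act (((evol ξ).restrictScalars ℤ : Derivation ℤ _ _) : Module.End ℤ (Jet m Γ R ι))
    (evol_der ξ) (evol_shift ξ) θ p

theorem evol_pair {κ : Type*} [Fintype κ] (ξ : ι → Jet m Γ R ι) (u w : κ → Jet m Γ R ι) :
    evol ξ (pair u w) = pair (evol ξ ∘ u) w + pair u (evol ξ ∘ w) := by
  simp only [pair, map_sum, Derivation.leibniz, smul_eq_mul, Finset.sum_add_distrib,
    Function.comp_apply]
  rw [add_comm]
  simp only [mul_comm]

theorem evol_trL {α β γ : Type*} [Fintype β] [Fintype γ]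
    (ξ : ι → Jet m Γ R ι) (A : BiOp m Γ R α β γ) (Y : β → Jet m Γ R ι) (w : γ → Jet m Γ R ι) :
    evol ξ ∘ A.trL MvPolynomial.C Y w
      = A.trL MvPolynomial.C (evol ξ ∘ Y) w + A.trL MvPolynomial.C Y (evol ξ ∘ w) :=
  BiOp.trL_derivation _ ((evol ξ).restrictScalars ℤ) (evol_der ξ) (evol_shift ξ) (evol_C ξ) A Y w

theorem evol_app {α β : Type*} [Fintype α] (ξ : ι → Jet m Γ R ι) (A : MatOp m Γ R α β)
    (X : α → Jet m Γ R ι) :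
    evol ξ ∘ A.app MvPolynomial.C X = A.app MvPolynomial.C (evol ξ ∘ X) :=
  MatOp.app_derivation _ ((evol ξ).restrictScalars ℤ) (evol_der ξ) (evol_shift ξ) (evol_C ξ) A X

theorem derivation_sum_apply {A : Type*} [CommRing A] [Algebra R A] {τ : Type*} (s : Finset τ)
    (D : τ → Derivation R A A) (x : A) : (∑ t ∈ s, D t) x = ∑ t ∈ s, D t x := by
  exact (congrFun (map_sum Derivation.coeFnAddMonoidHom D s) x).trans (Finset.sum_apply _ _ _)

/-- The commutator of two derivations is a derivation, and both fields commute with each ĝ∂^σ; hence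
the commutator is again evolutionary, determined by its values on the q_i. -/
theorem evol_evol_sub (ξ η : ι → Jet m Γ R ι) (p : Jet m Γ R ι) :
    evol ξ (evol η p) - evol η (evol ξ p) = evol (evol ξ ∘ η - evol η ∘ ξ) p := by
  have : ⁅evol ξ, evol η⁆ = evol (evol ξ ∘ η - evol η ∘ ξ) := by
    refine MvPolynomial.derivation_ext fun t => ?_
    simp only [Derivation.commutator_apply, evol_X, evol_act, Pi.sub_apply, Function.comp_apply]
    rw [sub_eq_add_neg, sub_eq_add_neg, act_add, act_neg]
  rw [← this, Derivation.commutator_apply]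

variable [Fintype ι]

/-- The first variation formula. -/
theorem sim_evol (ξ : ι → Jet m Γ R ι) (H : Jet m Γ R ι) :
    Sim m Γ (evol ξ H) (pair (varDer H) ξ) := by
  classical
  -- A single finite set of jet indices that serves all i at once; outside it the partial
  -- derivatives of H vanish.
  set T : Finset (Γ × (Fin m → ℕ)) := H.vars.image Prod.snd with hT
  have hvar : ∀ i, varDer H i = ∑ θ ∈ T, adj θ (MvPolynomial.pderiv (i, θ) H) := by
    intro i
    refine finsum_eq_sum_of_support_subset _ fun θ hθ => ?_
    by_contra h
    refine hθ ?_
    dsimp only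
    rw [MvPolynomial.pderiv_eq_zero_of_notMem_vars, adj_zero]
    exact fun h' => h (Finset.mem_coe.2 (Finset.mem_image_of_mem Prod.snd h'))
  have hev : evol ξ H
      = ∑ t ∈ Finset.univ ×ˢ T, MvPolynomial.pderiv t H * act t.2 (ξ t.1) := by
    have : evol ξ H = (∑ t ∈ (Finset.univ : Finset ι) ×ˢ T,
        act t.2 (ξ t.1) • MvPolynomial.pderiv t :
          Derivation R (Jet m Γ R ι) (Jet m Γ R ι)) H := by
      -- The truncated sum is not the evolutionary derivation itself, but the two agree on the
      -- variables occurring in H.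
      refine MvPolynomial.derivation_eq_of_forall_mem_vars fun t ht => ?_
      have ht' : t ∈ (Finset.univ : Finset ι) ×ˢ T :=
        Finset.mem_product.2 ⟨Finset.mem_univ _, Finset.mem_image_of_mem _ ht⟩
      rw [evol_X, derivation_sum_apply, Finset.sum_eq_single t]
      · simp
      · intro s _ hs
        simp [MvPolynomial.pderiv_X_of_ne hs.symm]
      · exact fun h => absurd ht' h
    rw [this, derivation_sum_apply]
    simp [mul_comm]
  rw [hev, Finset.sum_product]
  refine Sim.sum _ fun i _ => ?_
  rw [hvar, Finset.sum_mul]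
  exact Sim.sum _ fun θ _ => sim_act θ _ _

/-- The second variation is symmetric. -/
theorem sim_evol_varDer (ξ η : ι → Jet m Γ R ι) (H : Jet m Γ R ι) :
    Sim m Γ (pair (evol ξ ∘ varDer H) η) (pair (evol η ∘ varDer H) ξ) := by
  have h₁ := (sim_evol η H).evol ξ
  have h₂ := (sim_evol ξ H).evol η
  have h₃ := sim_evol (evol ξ ∘ η - evol η ∘ ξ) H
  rw [evol_pair] at h₁ h₂
  rw [← evol_evol_sub, pair_sub] at h₃
  -- The terms ⟨δH, ξ(η)⟩ and ⟨δH, η(ξ)⟩ from the Leibniz rule are exactly those given by the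
  -- commutator, so only the second variations survive.
  simp only [sim_iff, QuotientAddGroup.mk_add, QuotientAddGroup.mk_sub] at *
  linear_combination (norm := abel) h₂ - h₁ + h₃

/-- The Jacobi identity for the bracket `ω(δH, δF) ∼ ⟨δF, B(δH)⟩` reduces to a cyclic identity for
the derivative `dω` of the coefficients of `ω`. -/
theorem sim_jacobi_of_cyclic {ω : (ι → Jet m Γ R ι) → (ι → Jet m Γ R ι) → Jet m Γ R ι}
    {B : (ι → Jet m Γ R ι) → ι → Jet m Γ R ι}
    {dω : (ι → Jet m Γ R ι) → (ι → Jet m Γ R ι) → (ι → Jet m Γ R ι) → Jet m Γ R ι}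
    (hB : ∀ M N, Sim m Γ (ω M N) (pair N (B M))) (hskew : ∀ M N, Sim m Γ (ω M N) (-ω N M))
    (hω : ∀ ξ M N, evol ξ (ω M N) = dω ξ M N + ω (evol ξ ∘ M) N + ω M (evol ξ ∘ N))
    (hcyc : ∀ L M N, Sim m Γ (dω (B L) M N + dω (B M) N L + dω (B N) L M) 0)
    (H F G : Jet m Γ R ι) :
    Sim m Γ (ω (varDer (ω (varDer H) (varDer F))) (varDer G)
      + ω (varDer (ω (varDer F) (varDer G))) (varDer H)
      + ω (varDer (ω (varDer G) (varDer H))) (varDer F)) 0 := by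
  have key : ∀ H F G : Jet m Γ R ι,
      Sim m Γ (ω (varDer (ω (varDer H) (varDer F))) (varDer G))
        (-(dω (B (varDer G)) (varDer H) (varDer F)
          - pair (evol (B (varDer G)) ∘ varDer H) (B (varDer F))
          + pair (evol (B (varDer G)) ∘ varDer F) (B (varDer H)))) := by
    intro H F G
    -- Skewness puts the variational derivative of the inner bracket on the side where the first
    -- variation formula reads it as the evolution of that bracket along B(δG).
    refine ((hskew _ _).trans (hB _ _).neg).trans
      ((sim_evol (B (varDer G)) (ω (varDer H) (varDer F))).symm.neg.trans (Sim.neg ?_))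
    rw [hω, sub_eq_add_neg]
    exact ((Sim.of_eq rfl).add ((hskew _ _).trans (hB _ _).neg)).add (hB _ _)
  have k₁ := key H F G
  have k₂ := key F G H
  have k₃ := key G H F
  have s₁ := sim_evol_varDer (B (varDer F)) (B (varDer G)) H
  have s₂ := sim_evol_varDer (B (varDer G)) (B (varDer H)) F
  have s₃ := sim_evol_varDer (B (varDer H)) (B (varDer F)) G
  have c := hcyc (varDer G) (varDer H) (varDer F)
  simp only [sim_iff, QuotientAddGroup.mk_add, QuotientAddGroup.mk_sub,
    QuotientAddGroup.mk_neg, QuotientAddGroup.mk_zero] at *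
  -- The six second-variation terms cancel through `s₁`, `s₂`, `s₃`; the coefficient terms are the
  -- cyclic sum `c`.
  linear_combination (norm := abel) k₁ + k₂ + k₃ - c - s₁ - s₂ - s₃

/-- A bracket `ω(δH, δF) ∼ ⟨δF, B(δH)⟩` is Poisson if the derivative `dω` of the coefficients of
`ω` satisfies a cyclic identity. -/
theorem isPoisson_of_cyclic (ω : (ι → Jet m Γ R ι) → (ι → Jet m Γ R ι) → Jet m Γ R ι)
    (B : (ι → Jet m Γ R ι) → ι → Jet m Γ R ι)
    (dω : (ι → Jet m Γ R ι) → (ι → Jet m Γ R ι) → (ι → Jet m Γ R ι) → Jet m Γ R ι)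
    (hdiff : ∀ i, (fun M => B M i) ∈ diffOps m Γ (Jet m Γ R ι) ι)
    (hB : ∀ M N, Sim m Γ (ω M N) (pair N (B M))) (hskew : ∀ M N, Sim m Γ (ω M N) (-ω N M))
    (hω : ∀ ξ M N, evol ξ (ω M N) = dω ξ M N + ω (evol ξ ∘ M) N + ω M (evol ξ ∘ N))
    (hcyc : ∀ L M N, Sim m Γ (dω (B L) M N + dω (B M) N L + dω (B N) L M) 0) :
    IsPoisson fun H F : Jet m Γ R ι => ω (varDer H) (varDer F) where
  hamiltonian := by
    obtain ⟨A, hA⟩ := exists_matOp hdiff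
    exact ⟨A, fun H F => by rw [hA]; exact hB _ _⟩
  skew _ _ := hskew _ _
  jacobi := sim_jacobi_of_cyclic hB hskew hω hcyc

end Evolution

/-! ### The Yang-Baxter identity for an 𝒪-operator. -/

section OOperator

variable {m : ℕ} {Γ : Type v} [Group Γ] {R : Type u} [CommRing R] [DDRing m Γ R] {N : ℕ}
  {br : BiOp m Γ R (Fin N) (Fin N) (Fin N)} {O : MatOp m Γ R (Fin N) (Fin N)}
  {S : Type (max u v)} [CommRing S] [DDRing m Γ S] {φ : R →+* S}

/-- The classical Yang-Baxter identity in its cyclic form. -/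
theorem IsOOperator.sim_cyclic (hO : IsOOperator br O) (hbr : IsLie br) (hφ : IsExt m Γ φ)
    (u v w : Fin N → S) :
    Sim m Γ (pair u (br.app φ (O.app φ v) (O.app φ w))
      + pair v (br.app φ (O.app φ w) (O.app φ u))
      + pair w (br.app φ (O.app φ u) (O.app φ v))) 0 := by
  -- With this argument, one side of skewness is ⟨u, [O(v), O(w)]⟩ by the 𝒪-operator identity, and
  -- the other unfolds through the coadjoint action into the two remaining cyclic terms.
  have h := hO.skew S φ hφ u (coad φ br (O.app φ v) w - coad φ br (O.app φ w) v)
  rw [hO.hom S φ hφ, coad, coad, sub_pair, neg_pair, neg_pair] at h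
  have h₁ := br.trR_pair φ (O.app φ v) (O.app φ u) w
  have h₂ := br.trR_pair φ (O.app φ w) (O.app φ u) v
  rw [hbr.skew S φ hφ (O.app φ v) (O.app φ u), pair_neg] at h₁
  simp only [sim_iff, QuotientAddGroup.mk_add, QuotientAddGroup.mk_sub,
    QuotientAddGroup.mk_neg, QuotientAddGroup.mk_zero] at *
  linear_combination (norm := abel) h + h₁ - h₂

end OOperator


/-! ### The canonical form on V ⊕ V*. -/

section Symplectic

variable {m : ℕ} {Γ : Type v} {R : Type u} [CommRing R] {n : ℕ}

/-- Vectors of length `2n` over the ring of functions on `V ⊕ V^*`. -/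
abbrev PhaseVec (m : ℕ) (Γ : Type v) (R : Type u) [CommRing R] (n : ℕ) :=
  Fin n ⊕ Fin n → Phase m Γ R n

/-- The symplectic form `-N_xᵗ M_p + N_pᵗ M_x`. -/
noncomputable def sympForm (M N : PhaseVec m Γ R n) : Phase m Γ R n :=
  -pair (N ∘ Sum.inl) (M ∘ Sum.inr) + pair (N ∘ Sum.inr) (M ∘ Sum.inl)

/-- The matrix of the symplectic bracket. -/
noncomputable def sympOp (M : PhaseVec m Γ R n) : PhaseVec m Γ R n :=
  Sum.elim (-(M ∘ Sum.inr)) (M ∘ Sum.inl)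

theorem sympForm_eq_pair (M N : PhaseVec m Γ R n) : sympForm M N = pair N (sympOp M) := by
  rw [pair_sum_type, sympForm, sympOp, Sum.elim_comp_inl, Sum.elim_comp_inr, pair_neg]

theorem sympForm_skew (M N : PhaseVec m Γ R n) : sympForm M N = -sympForm N M := by
  rw [sympForm, sympForm, pair_comm (N ∘ _), pair_comm (N ∘ _)]
  ring

end Symplectic

/-! ### The quadratic form, its operator, and the cyclic identity. -/

section Brackets

variable {m : ℕ} {Γ : Type v} [Group Γ] {R : Type u} [CommRing R] [DDRing m Γ R] {N n : ℕ}
  (br : BiOp m Γ R (Fin N) (Fin N) (Fin N)) (χ : BiOp m Γ R (Fin N) (Fin n) (Fin n))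
  (O : MatOp m Γ R (Fin N) (Fin N))

/-- The vector `(𝐱, 𝐩)` of generators. -/
noncomputable def gens : PhaseVec m Γ R n := fun i => MvPolynomial.X (i, 1, 0)

/-- The bilinear map `((z_x, z_p), (M_x, M_p)) ↦ z_x ∇ M_x - M_p ∇ z_p`. -/
noncomputable def momentum (z M : PhaseVec m Γ R n) : Fin N → Phase m Γ R n :=
  nabla MvPolynomial.C χ (z ∘ Sum.inl) (M ∘ Sum.inl)
    - nabla MvPolynomial.C χ (M ∘ Sum.inr) (z ∘ Sum.inr)

/-- The element of `𝒢` which a covector `M` on the phase space determines through `O`. -/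
noncomputable def oVec (M : PhaseVec m Γ R n) : Fin N → Phase m Γ R n :=
  O.app MvPolynomial.C (momentum χ gens M)

/-- The representative `⟨u(M), O(u(N))⟩` of the quadratic form, `u = momentum χ gens`. -/
noncomputable def quadForm (M N : PhaseVec m Γ R n) : Phase m Γ R n :=
  pair (momentum χ gens M) (oVec χ O N)

/-- The derivative of `quadForm` along `ξ`. -/
noncomputable def quadFormDeriv (ξ M N : PhaseVec m Γ R n) : Phase m Γ R n :=
  pair (momentum χ ξ M) (oVec χ O N)
    + pair (momentum χ gens M) (O.app MvPolynomial.C (momentum χ ξ N))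

/-- The action of `Z ∈ 𝒢` on the generators of the phase space, with the opposite sign. -/
noncomputable def actGens (Z : Fin N → Phase m Γ R n) : PhaseVec m Γ R n :=
  Sum.elim (-χ.app MvPolynomial.C Z (gens ∘ Sum.inl))
    (χ.trR MvPolynomial.C Z (gens ∘ Sum.inr))

/-- The pairing `⟨M_x, Y.ξ_x⟩ - ⟨ξ_p, Y.M_p⟩ ∼ ⟨momentum χ ξ M, Y⟩`. -/
noncomputable def actPair (ξ M : PhaseVec m Γ R n) (Y : Fin N → Phase m Γ R n) :
    Phase m Γ R n :=
  pair (M ∘ Sum.inl) (χ.app MvPolynomial.C Y (ξ ∘ Sum.inl))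
    - pair (ξ ∘ Sum.inr) (χ.app MvPolynomial.C Y (M ∘ Sum.inr))

theorem sim_actPair (ξ M : PhaseVec m Γ R n) (Y : Fin N → Phase m Γ R n) :
    Sim m Γ (pair (momentum χ ξ M) Y) (actPair χ ξ M Y) := by
  rw [momentum, sub_pair]
  exact (χ.trL_pair _ _ _ _).sub (χ.trL_pair _ _ _ _)

/-- Differential operators act on the field argument, so only constant coefficients can be pulled
out. -/
theorem actPair_add_smul {c d : Phase m Γ R n} (hc : IsConst m Γ c) (hd : IsConst m Γ d)
    (ξ η M : PhaseVec m Γ R n) (Y : Fin N → Phase m Γ R n) :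
    actPair χ (c • ξ + d • η) M Y = c * actPair χ ξ M Y + d * actPair χ η M Y := by
  have e : ∀ f : Fin n → Fin n ⊕ Fin n, (c • ξ + d • η) ∘ f = c • (ξ ∘ f) + d • (η ∘ f) :=
    fun _ => rfl
  simp only [actPair, e, BiOp.app_add_right, BiOp.app_smul_right _ _ hc,
    BiOp.app_smul_right _ _ hd, pair_add, add_pair, pair_smul, smul_pair]
  ring

/-- Both sides equal -⟨M_x, Y.L_p⟩ - ⟨L_x, Y.M_p⟩. This symmetry says that the action of 𝒢 on V ⊕ V*
is infinitesimally symplectic, and it is the source of compatibility. -/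
theorem actPair_sympOp (L M : PhaseVec m Γ R n) (Y : Fin N → Phase m Γ R n) :
    actPair χ (sympOp L) M Y = actPair χ (sympOp M) L Y := by
  simp only [actPair, sympOp, Sum.elim_comp_inl, Sum.elim_comp_inr, BiOp.app_neg_right, pair_neg]
  ring

theorem sim_actPair_actGens (M : PhaseVec m Γ R n) (Y Z : Fin N → Phase m Γ R n) :
    Sim m Γ (actPair χ (actGens χ Z) M Y)
      (-pair (M ∘ Sum.inl) (χ.app MvPolynomial.C Y (χ.app MvPolynomial.C Z (gens ∘ Sum.inl)))
        - pair (gens ∘ Sum.inr)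
            (χ.app MvPolynomial.C Z (χ.app MvPolynomial.C Y (M ∘ Sum.inr)))) := by
  simp only [actPair, actGens, Sum.elim_comp_inl, Sum.elim_comp_inr, BiOp.app_neg_right, pair_neg]
  exact (Sim.of_eq rfl).sub (χ.trR_pair _ _ _ _)

variable {br χ O}

/-- The representation property expands the action of [Y, Z] on x and on M_p into commutators; on
the p-component the adjoint reverses the order of composition, which matches the minus sign in front
of that term of u(M). -/
theorem sim_momentum_bracket (hχ : IsRep br χ) (M : PhaseVec m Γ R n)
    (Y Z : Fin N → Phase m Γ R n) :
    Sim m Γ (pair (momentum χ gens M) (br.app MvPolynomial.C Y Z))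
      (actPair χ (actGens χ Y) M Z - actPair χ (actGens χ Z) M Y) := by
  have h := sim_actPair χ gens M (br.app MvPolynomial.C Y Z)
  have h₁ := sim_actPair_actGens χ M Y Z
  have h₂ := sim_actPair_actGens χ M Z Y
  rw [actPair, hχ _ _ isExt_C, hχ _ _ isExt_C, pair_sub, pair_sub] at h
  simp only [sim_iff, QuotientAddGroup.mk_sub, QuotientAddGroup.mk_neg] at *
  linear_combination (norm := abel) h + h₁ - h₂

theorem quadForm_skew (hO : IsOOperator br O) (M N : PhaseVec m Γ R n) :
    Sim m Γ (quadForm χ O M N) (-quadForm χ O N M) :=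
  hO.skew _ _ isExt_C _ _

/-- Skewness of O leaves -⟨u(N), O(u(M))⟩, and integration by parts then frees N from every
operator. This identifies the Hamiltonian operator Q of the quadratic bracket. -/
theorem sim_quadForm (hO : IsOOperator br O) (M N : PhaseVec m Γ R n) :
    Sim m Γ (quadForm χ O M N) (pair N (actGens χ (oVec χ O M))) := by
  refine (quadForm_skew hO M N).trans ((sim_actPair χ gens N _).neg.trans ?_)
  rw [pair_sum_type, actGens, Sum.elim_comp_inl, Sum.elim_comp_inr, pair_neg, actPair, neg_sub,
    sub_eq_neg_add]
  refine (Sim.of_eq rfl).add ?_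
  rw [pair_comm (N ∘ _)]
  exact (χ.trR_pair _ _ _ _).symm

/-- ∇ is bilinear with coefficients in R, which the evolution kills, so only the generators and M
are differentiated. -/
theorem evol_momentum (ξ M : PhaseVec m Γ R n) :
    evol ξ ∘ momentum χ gens M = momentum χ ξ M + momentum χ gens (evol ξ ∘ M) := by
  have hx : ∀ f : Fin n → Fin n ⊕ Fin n, evol ξ ∘ (gens ∘ f) = ξ ∘ f :=
    fun f => funext fun i => evol_gen ξ (f i)
  have hsub : ∀ f g : Fin N → Phase m Γ R n, evol ξ ∘ (f - g) = evol ξ ∘ f - evol ξ ∘ g :=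
    fun f g => funext fun i => map_sub _ _ _
  simp only [momentum, nabla, hsub, evol_trL, hx]
  simp only [Function.comp_assoc]
  abel

theorem evol_quadForm (ξ M N : PhaseVec m Γ R n) :
    evol ξ (quadForm χ O M N)
      = quadFormDeriv χ O ξ M N + quadForm χ O (evol ξ ∘ M) N + quadForm χ O M (evol ξ ∘ N) := by
  simp only [quadForm, quadFormDeriv, oVec, evol_pair, evol_app, evol_momentum, MatOp.app_add,
    add_pair, pair_add]
  ring

theorem evol_sympForm (ξ M N : PhaseVec m Γ R n) :
    evol ξ (sympForm M N) = sympForm (evol ξ ∘ M) N + sympForm M (evol ξ ∘ N) := by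
  simp only [sympForm, map_add, map_neg, evol_pair, Function.comp_assoc]
  ring

theorem sim_quadFormDeriv (hO : IsOOperator br O) (ξ M N : PhaseVec m Γ R n) :
    Sim m Γ (quadFormDeriv χ O ξ M N)
      (actPair χ ξ M (oVec χ O N) - actPair χ ξ N (oVec χ O M)) := by
  rw [sub_eq_add_neg]
  exact (sim_actPair χ ξ M _).add
    ((hO.skew _ _ isExt_C _ _).trans (sim_actPair χ ξ N _).neg)

/-- The cyclic identity behind the Jacobi identity of the pencil of brackets. -/
theorem sim_quadFormDeriv_cyclic (hbr : IsLie br) (hχ : IsRep br χ) (hO : IsOOperator br O)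
    {c d : Phase m Γ R n} (hc : IsConst m Γ c) (hd : IsConst m Γ d) (L M N : PhaseVec m Γ R n) :
    Sim m Γ (quadFormDeriv χ O (c • sympOp L + d • actGens χ (oVec χ O L)) M N
      + quadFormDeriv χ O (c • sympOp M + d • actGens χ (oVec χ O M)) N L
      + quadFormDeriv χ O (c • sympOp N + d • actGens χ (oVec χ O N)) L M) 0 := by
  have hL := sim_quadFormDeriv (χ := χ) hO (c • sympOp L + d • actGens χ (oVec χ O L)) M N
  have hM := sim_quadFormDeriv (χ := χ) hO (c • sympOp M + d • actGens χ (oVec χ O M)) N L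
  have hN := sim_quadFormDeriv (χ := χ) hO (c • sympOp N + d • actGens χ (oVec χ O N)) L M
  have kL := sim_momentum_bracket hχ L (oVec χ O M) (oVec χ O N)
  have kM := sim_momentum_bracket hχ M (oVec χ O N) (oVec χ O L)
  have kN := sim_momentum_bracket hχ N (oVec χ O L) (oVec χ O M)
  have h₀ := hO.sim_cyclic hbr isExt_C (momentum χ gens L) (momentum χ gens M) (momentum χ gens N)
  -- Collected by the covector not acted through O, the terms in d form minus the Yang-Baxter sum.
  have h := hd.sim_mul ((((kL.add kM).add kN).symm.trans h₀).neg)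
  refine ((hL.add hM).add hN).trans (Sim.trans (Sim.of_eq ?_) (h.trans (Sim.of_eq (by simp))))
  -- The terms in c cancel exactly, not only modulo ∼, once each symmetric pair is written in one
  -- fixed order.
  simp only [actPair_add_smul χ hc hd, actPair_sympOp χ M L, actPair_sympOp χ N L,
    actPair_sympOp χ N M]
  ring

/-- The four blocks of B are the expansion of one product in u = x∇M_x - M_p∇p. -/
theorem quadraticBracket_eq (H F : Phase m Γ R n) :
    quadraticBracket χ O H F = quadForm χ O (varDer H) (varDer F) := by
  have e : ∀ H : Phase m Γ R n, momentum χ gens (varDer H)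
      = nabla MvPolynomial.C χ vx (dx H) - nabla MvPolynomial.C χ (dp H) vp := fun _ => rfl
  simp only [quadForm, oVec, e, MatOp.app_sub, sub_pair, pair_sub, quadraticBracket]
  ring

theorem momentum_mem_diffOps (k : Fin N) :
    (fun M : PhaseVec m Γ R n => momentum χ gens M k)
      ∈ diffOps m Γ (Phase m Γ R n) (Fin n ⊕ Fin n) :=
  Submodule.sub_mem _
    (BiOp.trL_mem_diffOps_right _ _ _ (fun i => proj_mem_diffOps (Sum.inl i)) _)
    (BiOp.trL_mem_diffOps_left _ _ (fun i => proj_mem_diffOps (Sum.inr i)) _ _)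

theorem oVec_mem_diffOps (k : Fin N) :
    (fun M : PhaseVec m Γ R n => oVec χ O M k)
      ∈ diffOps m Γ (Phase m Γ R n) (Fin n ⊕ Fin n) :=
  MatOp.app_mem_diffOps _ _ momentum_mem_diffOps _

theorem actGens_oVec_mem_diffOps (i : Fin n ⊕ Fin n) :
    (fun M : PhaseVec m Γ R n => actGens χ (oVec χ O M) i)
      ∈ diffOps m Γ (Phase m Γ R n) (Fin n ⊕ Fin n) := by
  rcases i with i | i
  · exact (diffOps m Γ (Phase m Γ R n) (Fin n ⊕ Fin n)).neg_mem
      (BiOp.app_mem_diffOps _ χ (oVec_mem_diffOps (χ := χ) (O := O)) _ _)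
  · exact BiOp.trR_mem_diffOps _ χ (oVec_mem_diffOps (χ := χ) (O := O)) _ _

theorem sympOp_mem_diffOps (i : Fin n ⊕ Fin n) :
    (fun M : PhaseVec m Γ R n => sympOp M i)
      ∈ diffOps m Γ (Phase m Γ R n) (Fin n ⊕ Fin n) := by
  rcases i with i | i
  · exact (diffOps m Γ (Phase m Γ R n) (Fin n ⊕ Fin n)).neg_mem (proj_mem_diffOps (Sum.inr i))
  · exact proj_mem_diffOps (Sum.inl i)

end Brackets

end DDRing

/-! ### The pencil of brackets. -/

theorem proposition9p20 {m : ℕ} {Γ : Type v} [Group Γ] {R : Type u} [CommRing R] [DDRing m Γ R]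
    {N n : ℕ} (br : DDRing.BiOp m Γ R (Fin N) (Fin N) (Fin N)) (hbr : DDRing.IsLie br)
    (χ : DDRing.BiOp m Γ R (Fin N) (Fin n) (Fin n)) (hχ : DDRing.IsRep br χ)
    (O : DDRing.MatOp m Γ R (Fin N) (Fin N)) (hO : DDRing.IsOOperator br O) :
    DDRing.Compatible (DDRing.symplecticBracket (m := m) (Γ := Γ) (R := R) (n := n))
      (DDRing.quadraticBracket χ O) := by
  open DDRing in
  intro a b ha hb
  have hA : IsConst m Γ (MvPolynomial.C a : Phase m Γ R n) := ha.C
  have hB : IsConst m Γ (MvPolynomial.C b : Phase m Γ R n) := hb.C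
  have e : (fun H F : Phase m Γ R n => MvPolynomial.C a * symplecticBracket H F
        + MvPolynomial.C b * quadraticBracket χ O H F)
      = fun H F => MvPolynomial.C a * sympForm (varDer H) (varDer F)
        + MvPolynomial.C b * quadForm χ O (varDer H) (varDer F) := by
    funext H F
    rw [quadraticBracket_eq]
    rfl
  rw [e]
  refine isPoisson_of_cyclic
    (fun M N => MvPolynomial.C a * sympForm M N + MvPolynomial.C b * quadForm χ O M N)
    (fun M => (MvPolynomial.C a : Phase m Γ R n) • sympOp M
      + (MvPolynomial.C b : Phase m Γ R n) • actGens χ (oVec χ O M))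
    -- No term in a appears: the symplectic form has constant coefficients. The constant a enters
    -- the cyclic identity only through the operator.
    (fun ξ M N => MvPolynomial.C b * quadFormDeriv χ O ξ M N) ?_ ?_ ?_ ?_ ?_
  · exact fun i => Submodule.add_mem _ (mul_mem_diffOps _ (sympOp_mem_diffOps i))
      (mul_mem_diffOps _ (actGens_oVec_mem_diffOps i))
  · intro M N
    rw [pair_add, pair_smul, pair_smul, sympForm_eq_pair]
    exact (Sim.of_eq rfl).add (hB.sim_mul (sim_quadForm hO M N))
  · intro M N
    rw [neg_add, ← mul_neg, ← mul_neg, sympForm_skew M N]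
    exact (Sim.of_eq rfl).add (hB.sim_mul (quadForm_skew hO M N))
  · intro ξ M N
    simp only [map_add, Derivation.leibniz, evol_C, evol_sympForm, evol_quadForm, smul_eq_mul]
    ring
  · intro L M N
    have := hB.sim_mul (sim_quadFormDeriv_cyclic hbr hχ hO hA hB L M N)
    simpa only [mul_add, mul_zero] using this
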